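/- Consider $n$ qubits, with operators being complex $2^n\times 2^n$ matrices. A product of Pauli matrices is a tensor product $P=P_1\otimes\cdots\otimes P_n$ with each $P_i$ one of $I,\sigma_x,\sigma_y,\sigma_z$; its support is $\operatorname{supp}(P)=\{i : P_i\neq I\}$. The dual interaction graph of a finite family $(E_a)_a$ of products of Pauli matrices has the indices $a$ as vertices, with an edge between $a\neq b$ if and only if $\operatorname{supp}(E_a)\cap\operatorname{supp}(E_b)\neq\varnothing$. For an operator $O$ and a qubit $i$, put $O_{(i)}=O-\operatorname{tr}_i(O)\otimes\frac{I_i}{2}$, where $\operatorname{tr}_i$ is the partial trace over qubit $i$ and $I_i$ the identity on qubit $i$. **Theorem.** For all natural numbers $k,\mathfrak d,k',\mathfrak d'$ there are constants $c,c'>0$, depending only on $k,\mathfrak d,k',\mathfrak d'$, such that the following holds for every $n$. Let $H=\sum_{a=1}^m\lambda_aE_a$, where $-1\le\lambda_a\le1$ and the $E_a$ are distinct traceless products of Pauli matrices with $|\operatorname{supp}(E_a)|\le k$, whose dual interaction graph has maximum degree at most $\mathfrak d$. Let $A=\sum_{b=1}^{m'}\sigma_bP_b$, where $-1\le\sigma_b\le1$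 and the $P_b$ are products of Pauli matrices with $|\operatorname{supp}(P_b)|\le k'$, whose dual interaction graph has maximum degree at most $\mathfrak d'$. Let $\beta>0$ and let $\rho=e^{-\beta H}/\operatorname{tr}(e^{-\beta H})$ be the Gibbs state of $H$ at inverse temperature $\beta$. Then $$\operatorname{tr}(A^2\rho)\;\ge\;\max_{i\in\{1,\dots,n\}}\left(c\,\frac{\operatorname{tr}\bigl(A_{(i)}^2\bigr)}{2^n}\right)^{6+c'\beta}.$$ -/

import Mathlib

/-- Operators on `n` qubits: complex `2^n × 2^n` matrices, with rows and columns indexed by the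
computational basis `{0,1}^n`. -/
abbrev QubitOp (n : ℕ) : Type := Matrix (Fin n → Fin 2) (Fin n → Fin 2) ℂ

/-- The single-qubit Pauli matrices, in the order identity, `σ_x`, `σ_y`, `σ_z`. -/
noncomputable def pauliMatrix : Fin 4 → Matrix (Fin 2) (Fin 2) ℂ :=
  ![!![1, 0; 0, 1], !![0, 1; 1, 0], !![0, -Complex.I; Complex.I, 0], !![1, 0; 0, -1]]

/-- A label for a tensor product of Pauli matrices: one of the four Pauli matrices per qubit. -/
abbrev PauliString (n : ℕ) : Type := Fin n → Fin 4

/-- The operator `P_1 ⊗ ⋯ ⊗ P_n`. -/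
noncomputable def PauliString.toOp {n : ℕ} (P : PauliString n) : QubitOp n :=
  Matrix.of fun x y => ∏ i, pauliMatrix (P i) (x i) (y i)

/-- The support of `P_1 ⊗ ⋯ ⊗ P_n`: the qubits `i` with `P_i` not the identity. -/
def PauliString.support {n : ℕ} (P : PauliString n) : Finset (Fin n) :=
  Finset.univ.filter fun i => P i ≠ 0

/-- The linear combination `∑_a w_a E_a` of products of Pauli matrices. -/
noncomputable def pauliSum {n m : ℕ} (w : Fin m → ℝ) (E : Fin m → PauliString n) : QubitOp n :=
  ∑ a, (w a : ℂ) • (E a).toOp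

/-- The dual interaction graph of a family of products of Pauli matrices: its vertices are the
indices, and two different indices are adjacent iff the supports of their terms intersect. -/
def dualInteractionGraph {n m : ℕ} (E : Fin m → PauliString n) : SimpleGraph (Fin m) where
  Adj a b := a ≠ b ∧ ((E a).support ∩ (E b).support).Nonempty
  symm := ⟨fun a b h => ⟨h.1.symm, by rw [Finset.inter_comm]; exact h.2⟩⟩
  loopless := ⟨fun _ h => h.1 rfl⟩

instance dualInteractionGraphDecidableAdj {n m : ℕ} (E : Fin m → PauliString n) :
    DecidableRel (dualInteractionGraph E).Adj := fun a b =>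
  inferInstanceAs (Decidable (a ≠ b ∧ ((E a).support ∩ (E b).support).Nonempty))

/-- The Gibbs state `exp(-βH) / tr exp(-βH)`. -/
noncomputable def gibbsState {n : ℕ} (β : ℝ) (H : QubitOp n) : QubitOp n :=
  (NormedSpace.exp (-((β : ℂ) • H))).trace⁻¹ • NormedSpace.exp (-((β : ℂ) • H))

/-- The operator `tr_i(O) ⊗ (id_i / 2)`: the partial trace of `O` over qubit `i`, tensored with
the maximally mixed state on qubit `i`. -/
noncomputable def traceOutQubit {n : ℕ} (i : Fin n) (O : QubitOp n) : QubitOp n :=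
  Matrix.of fun x y =>
    if x i = y i then (∑ s : Fin 2, O (Function.update x i s) (Function.update y i s)) / 2 else 0

/-- The localization `O_(i) = O - tr_i(O) ⊗ (id_i / 2)` of an operator at qubit `i`. -/
noncomputable def localizeAt {n : ℕ} (i : Fin n) (O : QubitOp n) : QubitOp n :=
  O - traceOutQubit i O

/-! Write `ρ = g² / tr g²` with `g = e^K`, `K = -βH/2`. Then `tr(A²ρ) = κ²`, where `κ = ‖Ag‖ / ‖g‖`
in Hilbert–Schmidt norm, and it must be shown that a small `κ` forces `A_(i)` to be small at
infinite temperature.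

The heart is that `‖AVg‖` stays small for every Pauli product `V` near `i`
(`hsNorm_pauliSum_mul_toOp_mul_exp_le`). A spectral filter `Q = RA` of `A` at scale `√κ` makes both
`A(1-Q)` and `Qg` small. Since `A` commutes with `Q`, `AVg = A(1-Q)Vg + QVAg + Q[A,V]g`, and the
commutator has boundedly many local terms `M`. Each `QMg` is small by the three lines theorem
(`hsNorm_mul_exp_interpolation`), which needs only that `e^{-θK} M e^{θK}` be bounded. Locality of
`H` gives this for `θ` of order `1/(1+β)` (`norm_imaginary_evolution_le_two`), and `1/θ` becomes the
exponent linear in `β`.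

Finally, averaging `V A_(i)² V` over all `V` on a region containing the support of `A_(i)` gives the
normalized trace of `A_(i)²` times the identity (`sum_conj_pauliSum_sq`), so the bounds on `‖AVg‖`
bound that trace (`trace_localizeAt_sq_mul_le`). -/

open scoped Matrix.Norms.L2Operator

/-! ### Hilbert–Schmidt norm -/

section HilbertSchmidt

variable {ι : Type*} [Fintype ι]

/-- The entries of a matrix as a vector of Euclidean space, whose norm is the Hilbert–Schmidt
norm of the matrix. -/
noncomputable def hsVec (ι : Type*) [Fintype ι] : Matrix ι ι ℂ →ₗ[ℂ] EuclideanSpace ℂ (ι × ι) where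
  toFun X := WithLp.toLp 2 fun p => X p.1 p.2
  map_add' _ _ := rfl
  map_smul' _ _ := rfl

/-- The Hilbert–Schmidt norm. -/
noncomputable def hsNorm (X : Matrix ι ι ℂ) : ℝ := ‖hsVec ι X‖

lemma hsNorm_nonneg (X : Matrix ι ι ℂ) : 0 ≤ hsNorm X := norm_nonneg _

lemma hsNorm_sq (X : Matrix ι ι ℂ) : hsNorm X ^ 2 = ∑ j, ∑ i, ‖X i j‖ ^ 2 := by
  rw [hsNorm, EuclideanSpace.norm_sq_eq, Fintype.sum_prod_type, Finset.sum_comm]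
  rfl

lemma hsNorm_add_le (X Y : Matrix ι ι ℂ) : hsNorm (X + Y) ≤ hsNorm X + hsNorm Y := by
  simp only [hsNorm, map_add]; exact norm_add_le _ _

lemma hsNorm_sub_le (X Y : Matrix ι ι ℂ) : hsNorm (X - Y) ≤ hsNorm X + hsNorm Y := by
  simp only [hsNorm, map_sub]; exact norm_sub_le _ _

lemma hsNorm_smul (c : ℂ) (X : Matrix ι ι ℂ) : hsNorm (c • X) = ‖c‖ * hsNorm X := by
  simp only [hsNorm, map_smul]; exact norm_smul _ _

lemma hsNorm_sum_le {α : Type*} (s : Finset α) (f : α → Matrix ι ι ℂ) :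
    hsNorm (∑ a ∈ s, f a) ≤ ∑ a ∈ s, hsNorm (f a) := by
  simp only [hsNorm, map_sum]; exact norm_sum_le _ _

lemma hsNorm_eq_zero {X : Matrix ι ι ℂ} : hsNorm X = 0 ↔ X = 0 := by
  rw [hsNorm, norm_eq_zero]
  constructor
  · intro h
    ext i j
    exact congrArg (fun v : EuclideanSpace ℂ (ι × ι) => v (i, j)) h
  · rintro rfl
    exact map_zero _

lemma hsNorm_conjTranspose (X : Matrix ι ι ℂ) : hsNorm X.conjTranspose = hsNorm X := by
  have h : hsNorm X.conjTranspose ^ 2 = hsNorm X ^ 2 := by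
    rw [hsNorm_sq, hsNorm_sq, Finset.sum_comm]
    simp [Matrix.conjTranspose_apply]
  exact (pow_left_inj₀ (hsNorm_nonneg _) (hsNorm_nonneg _) two_ne_zero).1 h

lemma trace_conjTranspose_mul_self (X : Matrix ι ι ℂ) :
    (X.conjTranspose * X).trace = ((hsNorm X ^ 2 : ℝ) : ℂ) := by
  rw [hsNorm_sq, Matrix.trace]
  push_cast
  refine Finset.sum_congr rfl fun j _ => ?_
  rw [Matrix.diag_apply, Matrix.mul_apply]
  refine Finset.sum_congr rfl fun i _ => ?_
  rw [Matrix.conjTranspose_apply]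
  exact Complex.conj_mul' _

variable [DecidableEq ι]

/-- The operator norm bounds the action of `X` on each column of `Y`, and squared column norms add
up. -/
lemma hsNorm_mul_le (X Y : Matrix ι ι ℂ) : hsNorm (X * Y) ≤ ‖X‖ * hsNorm Y := by
  refine (sq_le_sq₀ (hsNorm_nonneg _) (mul_nonneg (norm_nonneg _) (hsNorm_nonneg _))).1 ?_
  rw [mul_pow, hsNorm_sq, hsNorm_sq, Finset.mul_sum]
  refine Finset.sum_le_sum fun j _ => ?_
  have h := Matrix.l2_opNorm_mulVec X (WithLp.toLp 2 fun i => Y i j)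
  have h2 := pow_le_pow_left₀ (norm_nonneg _) h 2
  rw [mul_pow, EuclideanSpace.norm_sq_eq, EuclideanSpace.norm_sq_eq] at h2
  exact h2

lemma hsNorm_mul_le' (X Y : Matrix ι ι ℂ) : hsNorm (X * Y) ≤ hsNorm X * ‖Y‖ := by
  rw [← hsNorm_conjTranspose, Matrix.conjTranspose_mul]
  refine (hsNorm_mul_le _ _).trans_eq ?_
  rw [hsNorm_conjTranspose, Matrix.l2_opNorm_conjTranspose, mul_comm]

end HilbertSchmidt

/-! ### Complex interpolation between `e^K` and `Q e^K` -/

section Interpolation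

variable {ι : Type*} [Fintype ι] [DecidableEq ι]

open NormedSpace

lemma exp_smul_mul_exp_smul (K : Matrix ι ι ℂ) (z w : ℂ) :
    exp (z • K) * exp (w • K) = exp ((z + w) • K) := by
  rw [add_smul]
  exact (Matrix.exp_add_of_commute _ _ (((Commute.refl K).smul_left z).smul_right w)).symm

lemma norm_exp_imaginary_smul [Nonempty ι] {K : Matrix ι ι ℂ} (hK : K.IsHermitian) (y : ℝ) :
    ‖exp ((Complex.I * y) • K)‖ = 1 := by
  let _ : NormedAlgebra ℚ (Matrix ι ι ℂ) := NormedAlgebra.restrictScalars ℚ ℂ _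
  apply CStarRing.norm_of_mem_unitary
  apply exp_mem_unitary_of_mem_skewAdjoint
  rw [skewAdjoint.mem_iff, star_smul, Matrix.star_eq_conjTranspose, hK]
  simp

lemma exp_smul_eq_imaginary_mul_real (K : Matrix ι ι ℂ) (z : ℂ) :
    exp (z • K) = exp ((Complex.I * z.im) • K) * exp ((z.re : ℂ) • K) := by
  rw [exp_smul_mul_exp_smul, add_comm, mul_comm Complex.I, Complex.re_add_im]

lemma exp_smul_eq_real_mul_imaginary (K : Matrix ι ι ℂ) (z : ℂ) :
    exp (z • K) = exp ((z.re : ℂ) • K) * exp ((Complex.I * z.im) • K) := by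
  rw [exp_smul_mul_exp_smul, mul_comm Complex.I, Complex.re_add_im]

/-- Hadamard's three lines theorem for `z ↦ Q e^{zK} B e^{(1-z)K}` in Hilbert–Schmidt norm. -/
lemma hsNorm_mul_exp_interpolation [Nonempty ι] {K : Matrix ι ι ℂ} (hK : K.IsHermitian)
    (Q M : Matrix ι ι ℂ) (hQ : ‖Q‖ ≤ 1) {C θ : ℝ} (hθ0 : 0 ≤ θ) (hθ1 : θ ≤ 1)
    (hC : ‖exp ((-θ : ℂ) • K) * M * exp ((θ : ℂ) • K)‖ ≤ C) :
    hsNorm (Q * M * exp K) ≤ (C * hsNorm (exp K)) ^ (1 - θ) * (C * hsNorm (Q * exp K)) ^ θ := by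
  have hC0 : 0 ≤ C := (norm_nonneg _).trans hC
  set B := exp ((-θ : ℂ) • K) * M * exp ((θ : ℂ) • K) with hB
  -- At `z = θ` the exponentials around `M` cancel and `Q M e^K` remains. Imaginary powers are
  -- unitary, so the edge `Re z = 0` is bounded by `C ‖e^K‖`; on `Re z = 1` the factor `e^K` stands
  -- next to `Q`, whence `C ‖Q e^K‖`.
  let F : ℂ → EuclideanSpace ℂ (ι × ι) := fun z =>
    hsVec ι (Q * exp (z • K) * B * exp ((1 - z) • K))
  have hF : ∀ z, ‖F z‖ = hsNorm (Q * exp (z • K) * B * exp ((1 - z) • K)) := fun z => rfl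
  have hdiff : Differentiable ℂ F := by
    have h1 : Differentiable ℂ fun z : ℂ => exp (z • K) := differentiable_exp_smul_const ℂ K
    have h2 : Differentiable ℂ fun z : ℂ => exp ((1 - z) • K) :=
      h1.comp (differentiable_id.const_sub 1)
    have h3 : Differentiable ℂ fun z : ℂ => Q * exp (z • K) * B * exp ((1 - z) • K) :=
      (((differentiable_const Q).mul h1).mul (differentiable_const B)).mul h2
    exact (LinearMap.toContinuousLinearMap (hsVec ι)).differentiable.comp h3
  have hθF : F θ = hsVec ι (Q * M * exp K) := by
    have e1 : exp ((θ : ℂ) • K) * exp ((-θ : ℂ) • K) = 1 := by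
      rw [exp_smul_mul_exp_smul]; simp
    have e2 : exp ((θ : ℂ) • K) * exp ((1 - θ : ℂ) • K) = exp K := by
      rw [exp_smul_mul_exp_smul]; simp
    have : Q * exp ((θ : ℂ) • K) * B * exp ((1 - θ : ℂ) • K)
        = Q * (exp ((θ : ℂ) • K) * exp ((-θ : ℂ) • K)) * M *
          (exp ((θ : ℂ) • K) * exp ((1 - θ : ℂ) • K)) := by
      rw [hB]; noncomm_ring
    change hsVec ι _ = _
    rw [this, e1, e2, mul_one]
  have hu : ∀ y : ℝ, ‖exp ((Complex.I * y) • K)‖ = 1 := norm_exp_imaginary_smul hK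
  have hbound := Complex.HadamardThreeLines.norm_le_interp_of_mem_verticalClosedStrip₀₁' F
    (z := (θ : ℂ)) (a := C * hsNorm (exp K)) (b := C * hsNorm (Q * exp K))
    (by simp [Complex.HadamardThreeLines.verticalClosedStrip, hθ0, hθ1])
    hdiff.diffContOnCl ?_ ?_ ?_
  · rw [hθF, Complex.ofReal_re] at hbound
    exact hbound
  -- A priori boundedness on the strip: unitarity reduces it to real exponents in the compact
  -- interval `[0, 1]`.
  · have hc : Continuous fun t : ℝ => ‖exp ((t : ℂ) • K)‖ := by
      have h1 : Differentiable ℂ fun z : ℂ => exp (z • K) := differentiable_exp_smul_const ℂ K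
      exact (h1.continuous.comp Complex.continuous_ofReal).norm
    obtain ⟨D, hD⟩ := (isCompact_Icc (a := (0 : ℝ)) (b := 1)).bddAbove_image hc.continuousOn
    have hD' : ∀ z : ℂ, 0 ≤ z.re → z.re ≤ 1 → ‖exp (z • K)‖ ≤ D := by
      intro z h0 h1
      rw [exp_smul_eq_imaginary_mul_real]
      refine (norm_mul_le _ _).trans ?_
      rw [hu, one_mul]
      exact hD ⟨z.re, ⟨h0, h1⟩, rfl⟩
    have hD0 : 0 ≤ D := (norm_nonneg _).trans (hD' 0 (by simp) (by simp))
    refine ⟨hsNorm Q * D * ‖B‖ * D, ?_⟩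
    rintro _ ⟨z, ⟨h0, h1⟩, rfl⟩
    simp only [Function.comp_apply, hF]
    have ha := hsNorm_mul_le' (Q * exp (z • K) * B) (exp ((1 - z) • K))
    have hb := hsNorm_mul_le' (Q * exp (z • K)) B
    have hc := hsNorm_mul_le' Q (exp (z • K))
    have hd := hD' z h0 h1
    have he := hD' (1 - z) (by simpa using h1) (by simpa using h0)
    have := hsNorm_nonneg Q
    have := hsNorm_nonneg (Q * exp (z • K))
    have := hsNorm_nonneg (Q * exp (z • K) * B)
    calc _ ≤ _ := ha
      _ ≤ hsNorm (Q * exp (z • K) * B) * D := by gcongr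
      _ ≤ hsNorm (Q * exp (z • K)) * ‖B‖ * D := by gcongr
      _ ≤ hsNorm Q * ‖exp (z • K)‖ * ‖B‖ * D := by gcongr
      _ ≤ hsNorm Q * D * ‖B‖ * D := by gcongr
  · intro z hz
    have hz : z.re = 0 := hz
    rw [hF, exp_smul_eq_imaginary_mul_real K z, exp_smul_eq_imaginary_mul_real K (1 - z)]
    simp only [hz, Complex.sub_re, Complex.one_re, sub_zero, Complex.ofReal_zero, zero_smul,
      exp_zero, mul_one, Complex.ofReal_one, one_smul, ← mul_assoc]
    refine (hsNorm_mul_le _ _).trans ?_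
    gcongr
    · exact hsNorm_nonneg _
    refine (norm_mul_le _ _).trans ?_
    rw [hu, mul_one]
    refine (norm_mul_le _ _).trans ?_
    refine (mul_le_of_le_one_left (norm_nonneg _) ?_).trans hC
    refine (norm_mul_le _ _).trans ?_
    rw [hu, mul_one]
    exact hQ
  · intro z hz
    have hz : z.re = 1 := hz
    rw [hF, exp_smul_eq_real_mul_imaginary K z, exp_smul_eq_imaginary_mul_real K (1 - z)]
    simp only [hz, Complex.sub_re, Complex.one_re, sub_self, Complex.ofReal_zero, zero_smul,
      exp_zero, mul_one, Complex.ofReal_one, one_smul, ← mul_assoc]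
    have ha := hsNorm_mul_le' (Q * exp K * exp ((Complex.I * z.im) • K) * B)
      (exp ((Complex.I * (1 - z).im) • K))
    have hb := hsNorm_mul_le' (Q * exp K * exp ((Complex.I * z.im) • K)) B
    have hc := hsNorm_mul_le' (Q * exp K) (exp ((Complex.I * z.im) • K))
    rw [hu, mul_one] at ha hc
    have := hsNorm_nonneg (Q * exp K)
    calc _ ≤ _ := ha
      _ ≤ _ := hb
      _ ≤ hsNorm (Q * exp K) * C := by gcongr
      _ = _ := mul_comm _ _

end Interpolation

/-! ### Algebra of single-qubit Pauli matrices -/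

section SingleQubitPauli

/-- The sign `±1` with which two single-qubit Pauli matrices commute. -/
def pauliSign (a b : Fin 4) : ℤ := if a = 0 ∨ b = 0 ∨ a = b then 1 else -1

/-- The last clause serves to keep the support of a product of strings inside the union of the
supports. -/
lemma pauliMatrix_mul (a b : Fin 4) : ∃ (w : Fin 4) (c : ℂ), ‖c‖ = 1 ∧
    pauliMatrix a * pauliMatrix b = c • pauliMatrix w ∧ (a = 0 → b = 0 → w = 0) := by
  have h : ∀ (w : Fin 4) (c : ℂ), ‖c‖ = 1 →
      pauliMatrix a * pauliMatrix b = c • pauliMatrix w → (a = 0 → b = 0 → w = 0) →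
      ∃ (w : Fin 4) (c : ℂ), ‖c‖ = 1 ∧
        pauliMatrix a * pauliMatrix b = c • pauliMatrix w ∧ (a = 0 → b = 0 → w = 0) :=
    fun w c h1 h2 h3 => ⟨w, c, h1, h2, h3⟩
  fin_cases a <;> fin_cases b
  · exact h 0 1 (by simp) (by simp [pauliMatrix]) (by simp)
  · exact h 1 1 (by simp) (by simp [pauliMatrix]) (by simp)
  · exact h 2 1 (by simp) (by simp [pauliMatrix]) (by simp)
  · exact h 3 1 (by simp) (by simp [pauliMatrix]) (by simp)
  · exact h 1 1 (by simp) (by simp [pauliMatrix]) (by simp)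
  · exact h 0 1 (by simp) (by simp [pauliMatrix]) (by simp)
  · exact h 3 Complex.I (by simp) (by simp [pauliMatrix]) (by simp)
  · exact h 2 (-Complex.I) (by simp) (by simp [pauliMatrix]) (by simp)
  · exact h 2 1 (by simp) (by simp [pauliMatrix]) (by simp)
  · exact h 3 (-Complex.I) (by simp) (by simp [pauliMatrix]) (by simp)
  · exact h 0 1 (by simp) (by simp [pauliMatrix]) (by simp)
  · exact h 1 Complex.I (by simp) (by simp [pauliMatrix]) (by simp)
  · exact h 3 1 (by simp) (by simp [pauliMatrix]) (by simp)
  · exact h 2 Complex.I (by simp) (by simp [pauliMatrix]) (by simp)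
  · exact h 1 (-Complex.I) (by simp) (by simp [pauliMatrix]) (by simp)
  · exact h 0 1 (by simp) (by simp [pauliMatrix]) (by simp)

lemma pauliMatrix_zero : pauliMatrix 0 = 1 := by
  simp [pauliMatrix, Matrix.one_fin_two]

lemma pauliMatrix_mul_self (a : Fin 4) : pauliMatrix a * pauliMatrix a = 1 := by
  fin_cases a <;> simp [pauliMatrix, Matrix.one_fin_two]

lemma pauliMatrix_conjTranspose (a : Fin 4) : (pauliMatrix a).conjTranspose = pauliMatrix a := by
  ext i j
  fin_cases a <;> fin_cases i <;> fin_cases j <;> simp [pauliMatrix]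

lemma pauliMatrix_mul_comm (a b : Fin 4) :
    pauliMatrix a * pauliMatrix b = (pauliSign a b : ℂ) • (pauliMatrix b * pauliMatrix a) := by
  fin_cases a <;> fin_cases b <;> simp [pauliMatrix, pauliSign]

lemma trace_pauliMatrix_mul (a b : Fin 4) :
    (pauliMatrix a * pauliMatrix b).trace = if a = b then 2 else 0 := by
  fin_cases a <;> fin_cases b <;> norm_num [pauliMatrix, Matrix.trace_fin_two]

/-- The signs `v ↦ pauliSign v a` are the four characters of the Klein group, hence orthogonal. -/
lemma sum_pauliSign_mul (a b : Fin 4) :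
    ∑ v, pauliSign v a * pauliSign v b = if a = b then 4 else 0 := by
  revert a b; decide

end SingleQubitPauli

/-! ### Tensor products of single-qubit matrices -/

section TensorPower

variable {n : ℕ}

/-- The tensor product of single-qubit matrices. -/
def tensorOp (M : Fin n → Matrix (Fin 2) (Fin 2) ℂ) : QubitOp n :=
  Matrix.of fun x y => ∏ i, M i (x i) (y i)

lemma tensorOp_mul (M N : Fin n → Matrix (Fin 2) (Fin 2) ℂ) :
    tensorOp M * tensorOp N = tensorOp fun i => M i * N i := by
  ext x y
  simp only [tensorOp, Matrix.mul_apply, Matrix.of_apply, ← Finset.prod_mul_distrib]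
  rw [Finset.prod_univ_sum, Fintype.piFinset_univ]

lemma tensorOp_smul (c : Fin n → ℂ) (M : Fin n → Matrix (Fin 2) (Fin 2) ℂ) :
    tensorOp (fun i => c i • M i) = (∏ i, c i) • tensorOp M := by
  ext x y
  simp [tensorOp, Finset.prod_mul_distrib]

lemma tensorOp_one : tensorOp (fun _ : Fin n => 1) = 1 := by
  ext x y
  simp only [tensorOp, Matrix.of_apply, Matrix.one_apply, Finset.prod_ite_zero]
  simp [funext_iff]

lemma tensorOp_conjTranspose (M : Fin n → Matrix (Fin 2) (Fin 2) ℂ) :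
    (tensorOp M).conjTranspose = tensorOp fun i => (M i).conjTranspose := by
  ext x y
  simp [tensorOp, Matrix.conjTranspose_apply]

lemma trace_tensorOp (M : Fin n → Matrix (Fin 2) (Fin 2) ℂ) :
    (tensorOp M).trace = ∏ i, (M i).trace := by
  simp only [tensorOp, Matrix.trace, Matrix.diag_apply, Matrix.of_apply]
  rw [Finset.prod_univ_sum, Fintype.piFinset_univ]

end TensorPower

/-! ### Products of Pauli matrices and their commutation signs -/

namespace PauliString

variable {n : ℕ}

/-- The sign `±1` with which two products of Pauli matrices commute. -/
def sign (P Q : PauliString n) : ℤ := ∏ i, pauliSign (P i) (Q i)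

lemma toOp_eq_tensorOp (P : PauliString n) : P.toOp = tensorOp fun i => pauliMatrix (P i) := rfl

lemma mem_support {P : PauliString n} {i : Fin n} : i ∈ P.support ↔ P i ≠ 0 := by
  simp [support]

lemma exists_toOp_mul (P Q : PauliString n) : ∃ (W : PauliString n) (c : ℂ), ‖c‖ = 1 ∧
    P.toOp * Q.toOp = c • W.toOp ∧ W.support ⊆ P.support ∪ Q.support := by
  choose w c hc hmul h0 using pauliMatrix_mul
  refine ⟨fun i => w (P i) (Q i), ∏ i, c (P i) (Q i), ?_, ?_, ?_⟩
  · simp [hc]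
  · simp only [toOp_eq_tensorOp, tensorOp_mul, ← tensorOp_smul, hmul]
  · intro i hi
    rw [mem_support] at hi
    by_contra h
    simp only [Finset.mem_union, mem_support, not_or, not_not] at h
    exact hi (h0 _ _ h.1 h.2)

lemma toOp_mul_self (P : PauliString n) : P.toOp * P.toOp = 1 := by
  simp only [toOp_eq_tensorOp, tensorOp_mul, pauliMatrix_mul_self, tensorOp_one]

lemma isHermitian_toOp (P : PauliString n) : P.toOp.IsHermitian := by
  rw [Matrix.IsHermitian, toOp_eq_tensorOp, tensorOp_conjTranspose]
  simp only [pauliMatrix_conjTranspose]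

lemma norm_toOp (P : PauliString n) : ‖P.toOp‖ = 1 := by
  apply CStarRing.norm_of_mem_unitary
  rw [Unitary.mem_iff, Matrix.star_eq_conjTranspose, P.isHermitian_toOp]
  exact ⟨P.toOp_mul_self, P.toOp_mul_self⟩

lemma toOp_mul_comm (P Q : PauliString n) :
    P.toOp * Q.toOp = (sign P Q : ℂ) • (Q.toOp * P.toOp) := by
  simp only [toOp_eq_tensorOp, tensorOp_mul, sign, Int.cast_prod, ← tensorOp_smul,
    ← pauliMatrix_mul_comm]

lemma toOp_conj (V P : PauliString n) :
    V.toOp * P.toOp * V.toOp = (sign V P : ℂ) • P.toOp := by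
  rw [toOp_mul_comm V P, smul_mul_assoc, mul_assoc, toOp_mul_self, mul_one]

lemma sign_eq_one_or (P Q : PauliString n) : sign P Q = 1 ∨ sign P Q = -1 := by
  refine Int.isUnit_iff.1 (IsUnit.prod_iff.2 fun i _ => ?_)
  rw [pauliSign]; split_ifs <;> simp

lemma sign_eq_one_of_disjoint {P Q : PauliString n}
    (h : ¬ (P.support ∩ Q.support).Nonempty) : sign P Q = 1 := by
  refine Finset.prod_eq_one fun i _ => ?_
  rw [pauliSign, if_pos]
  by_contra hi
  push Not at hi
  exact h ⟨i, Finset.mem_inter.2 ⟨mem_support.2 hi.1, mem_support.2 hi.2.1⟩⟩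

lemma trace_toOp_mul (P Q : PauliString n) :
    (P.toOp * Q.toOp).trace = if P = Q then 2 ^ n else 0 := by
  simp only [toOp_eq_tensorOp, tensorOp_mul, trace_tensorOp, trace_pauliMatrix_mul,
    Finset.prod_ite_zero]
  simp [funext_iff]

/-- The products of Pauli matrices whose support lies in `L`. -/
def supportedOn (L : Finset (Fin n)) : Finset (PauliString n) :=
  Fintype.piFinset fun i => if i ∈ L then Finset.univ else {0}

lemma mem_supportedOn {L : Finset (Fin n)} {V : PauliString n} :
    V ∈ supportedOn L ↔ V.support ⊆ L := by
  simp only [supportedOn, Fintype.mem_piFinset, Finset.subset_iff, mem_support]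
  refine forall_congr' fun i => ?_
  by_cases h : i ∈ L <;> simp [h]

lemma card_supportedOn (L : Finset (Fin n)) : (supportedOn L).card = 4 ^ L.card := by
  rw [supportedOn, Fintype.card_piFinset]
  simp only [apply_ite Finset.card, Finset.card_univ, Fintype.card_fin, Finset.card_singleton]
  simp

/-- Character orthogonality, qubit by qubit: each qubit of `L` gives `4` or `0`, and outside `L` all
strings are trivial and contribute `1`. -/
lemma sum_sign_mul_sign {L : Finset (Fin n)} {P Q : PauliString n}
    (hP : P.support ⊆ L) (hQ : Q.support ⊆ L) :
    ∑ V ∈ supportedOn L, sign V P * sign V Q = if P = Q then 4 ^ L.card else 0 := by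
  have hz : ∀ i, ∑ v ∈ (if i ∈ L then Finset.univ else {0}), pauliSign v (P i) * pauliSign v (Q i)
      = if P i = Q i then (if i ∈ L then 4 else 1) else 0 := by
    intro i
    by_cases h : i ∈ L
    · simp only [h, if_true, sum_pauliSign_mul]
    · have h1 : P i = 0 := by
        by_contra h'; exact h (hP (mem_support.2 h'))
      have h2 : Q i = 0 := by
        by_contra h'; exact h (hQ (mem_support.2 h'))
      simp [h, h1, h2, pauliSign]
  simp only [sign, ← Finset.prod_mul_distrib, supportedOn]
  rw [← Finset.prod_univ_sum (fun i => if i ∈ L then Finset.univ else {0})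
    (fun i v => pauliSign v (P i) * pauliSign v (Q i))]
  simp only [hz, Finset.prod_ite_zero]
  simp [funext_iff]

end PauliString

/-! ### Counting terms near a set of qubits -/

section InteractionGraph

variable {n m : ℕ}

/-- In a family whose dual interaction graph has degree at most `d`, at most `(d + 1) |S|` terms
touch a set `S` of qubits. -/
lemma card_support_inter_nonempty_le {E : Fin m → PauliString n} {d : ℕ}
    (hd : (dualInteractionGraph E).maxDegree ≤ d) (S : Finset (Fin n)) :
    (Finset.univ.filter fun a => ((E a).support ∩ S).Nonempty).card ≤ S.card * (d + 1) := by
  have hsub : (Finset.univ.filter fun a => ((E a).support ∩ S).Nonempty) ⊆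
      S.biUnion fun j => Finset.univ.filter fun a => j ∈ (E a).support := by
    intro a ha
    obtain ⟨j, hj⟩ := (Finset.mem_filter.1 ha).2
    rw [Finset.mem_inter] at hj
    exact Finset.mem_biUnion.2 ⟨j, hj.2, Finset.mem_filter.2 ⟨Finset.mem_univ _, hj.1⟩⟩
  refine (Finset.card_le_card hsub).trans (Finset.card_biUnion_le_card_mul _ _ _ fun j _ => ?_)
  -- Terms containing `j` are pairwise adjacent, so they all lie in the closed neighbourhood of any
  -- one of them.
  by_cases hj : ∃ a, j ∈ (E a).support
  · obtain ⟨a, ha⟩ := hj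
    have h2 : (Finset.univ.filter fun b => j ∈ (E b).support) ⊆
        insert a ((dualInteractionGraph E).neighborFinset a) := by
      intro b hb
      rw [Finset.mem_insert, SimpleGraph.mem_neighborFinset]
      by_cases hab : b = a
      · exact Or.inl hab
      · exact Or.inr ⟨fun h => hab h.symm, j, Finset.mem_inter.2 ⟨ha, (Finset.mem_filter.1 hb).2⟩⟩
    refine (Finset.card_le_card h2).trans ((Finset.card_insert_le _ _).trans ?_)
    rw [SimpleGraph.card_neighborFinset_eq_degree]
    exact Nat.succ_le_succ (((dualInteractionGraph E).degree_le_maxDegree a).trans hd)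
  · push Not at hj
    simp [hj]

end InteractionGraph

/-! ### Conjugation by exponentials as a commutator series -/

section ExpConjugation

variable {𝔸 : Type*} [NormedRing 𝔸] [NormedAlgebra ℂ 𝔸]

open NormedSpace

/-- The commutator with `H` as a bounded operator. -/
noncomputable def commutatorCLM (H : 𝔸) : 𝔸 →L[ℂ] 𝔸 :=
  ContinuousLinearMap.mul ℂ 𝔸 H - (ContinuousLinearMap.mul ℂ 𝔸).flip H

lemma commutatorCLM_apply (H V : 𝔸) : commutatorCLM H V = H * V - V * H := rfl

variable [CompleteSpace 𝔸]

lemma hasSum_exp_smul_apply (t : ℂ) (T : 𝔸 →L[ℂ] 𝔸) (V : 𝔸) :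
    HasSum (fun j : ℕ => ((j.factorial : ℂ)⁻¹ * t ^ j) • (T ^ j) V) (exp (t • T) V) := by
  have h := (exp_series_hasSum_exp' (𝕂 := ℂ) (t • T)).mapL (ContinuousLinearMap.apply ℂ 𝔸 V)
  refine h.congr_fun fun j => ?_
  have hp : ((t • T) ^ j) V = t ^ j • (T ^ j) V := by
    induction j with
    | zero => simp
    | succ j ih =>
      rw [pow_succ', mul_apply_eq_comp, ih, pow_succ', pow_succ', mul_apply_eq_comp, mul_smul,
        smul_apply, map_smul]
  rw [mul_smul, ← hp]
  rfl

lemma exp_smul_mulLeft_apply (t : ℂ) (H V : 𝔸) :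
    exp (t • ContinuousLinearMap.mul ℂ 𝔸 H) V = exp (t • H) * V := by
  refine (hasSum_exp_smul_apply t _ V).unique ?_
  have h : ∀ j : ℕ, ((ContinuousLinearMap.mul ℂ 𝔸 H) ^ j) V = H ^ j * V := by
    intro j
    induction j with
    | zero => simp
    | succ j ih => rw [pow_succ', mul_apply_eq_comp, ih, pow_succ', mul_assoc]; rfl
  refine HasSum.congr_fun ((exp_series_hasSum_exp' (𝕂 := ℂ) (t • H)).mul_right V) fun j => ?_
  rw [h, smul_pow, smul_smul, smul_mul_assoc]

lemma exp_smul_mulRight_apply (t : ℂ) (H V : 𝔸) :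
    exp (t • (ContinuousLinearMap.mul ℂ 𝔸).flip H) V = V * exp (t • H) := by
  refine (hasSum_exp_smul_apply t _ V).unique ?_
  have h : ∀ j : ℕ, (((ContinuousLinearMap.mul ℂ 𝔸).flip H) ^ j) V = V * H ^ j := by
    intro j
    induction j with
    | zero => simp
    | succ j ih => rw [pow_succ', mul_apply_eq_comp, ih, pow_succ, ← mul_assoc]; rfl
  refine HasSum.congr_fun ((exp_series_hasSum_exp' (𝕂 := ℂ) (t • H)).mul_left V) fun j => ?_
  rw [h, smul_pow, smul_smul, mul_smul_comm]

/-- Left and right multiplication by `H` commute, so the exponential of their difference factors. -/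
lemma exp_smul_mul_mul_exp_neg_smul (t : ℂ) (H V : 𝔸) :
    exp (t • H) * V * exp (-t • H) = exp (t • commutatorCLM H) V := by
  let _ : NormedAlgebra ℚ (𝔸 →L[ℂ] 𝔸) := NormedAlgebra.restrictScalars ℚ ℂ _
  have hcomm : Commute (-t • (ContinuousLinearMap.mul ℂ 𝔸).flip H)
      (t • ContinuousLinearMap.mul ℂ 𝔸 H) := by
    refine (Commute.smul_left ?_ _).smul_right _
    ext x
    exact mul_assoc H x H
  have h : t • commutatorCLM H = -t • (ContinuousLinearMap.mul ℂ 𝔸).flip H +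
      t • ContinuousLinearMap.mul ℂ 𝔸 H := by
    rw [commutatorCLM, smul_sub, neg_smul]; abel
  rw [h, exp_add_of_commute hcomm, mul_apply_eq_comp, exp_smul_mulLeft_apply,
    exp_smul_mulRight_apply]

/-- The factorial growth cancels the `1/j!` of the exponential series, leaving a geometric series of
ratio `1/2`. -/
lemma norm_exp_conj_le_two {H V : 𝔸} {a : ℝ} {t : ℂ}
    (h : ∀ j : ℕ, ‖(commutatorCLM H ^ j) V‖ ≤ a ^ j * j.factorial) (ht : ‖t‖ * a ≤ 1 / 2)
    (ha : 0 ≤ a) : ‖exp (t • H) * V * exp (-t • H)‖ ≤ 2 := by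
  rw [exp_smul_mul_mul_exp_neg_smul, ← (hasSum_exp_smul_apply t _ V).tsum_eq]
  refine tsum_of_norm_bounded hasSum_geometric_two fun j => ?_
  rw [norm_smul, norm_mul, norm_inv, norm_pow, Complex.norm_natCast]
  have hj : (0 : ℝ) < j.factorial := by exact_mod_cast j.factorial_pos
  calc ((j.factorial : ℝ)⁻¹ * ‖t‖ ^ j) * ‖(commutatorCLM H ^ j) V‖
      ≤ ((j.factorial : ℝ)⁻¹ * ‖t‖ ^ j) * (a ^ j * j.factorial) := by gcongr; exact h j
    _ = (‖t‖ * a) ^ j := by rw [mul_pow]; field_simp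
    _ ≤ (1 / 2) ^ j := by gcongr

end ExpConjugation

/-! ### Short imaginary time evolution under a local Hamiltonian -/

section LocalHamiltonian

variable {n m : ℕ}

/-- The factor `1 - sign` removes every term commuting with `V`, in particular those with disjoint
support. -/
lemma commutatorCLM_pauliSum (lam : Fin m → ℝ) (E : Fin m → PauliString n) (V : PauliString n) :
    commutatorCLM (pauliSum lam E) V.toOp =
      ∑ a, ((lam a : ℂ) * (1 - PauliString.sign V (E a))) • ((E a).toOp * V.toOp) := by
  rw [commutatorCLM_apply, pauliSum, Finset.sum_mul, Finset.mul_sum, ← Finset.sum_sub_distrib]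
  refine Finset.sum_congr rfl fun a _ => ?_
  rw [mul_smul_comm, PauliString.toOp_mul_comm V (E a), smul_mul_assoc, ← smul_sub, mul_smul,
    sub_smul, one_smul]

/-- Iterated commutators of a local Hamiltonian with a product of Pauli matrices. -/
lemma norm_commutatorCLM_pow_le {k d : ℕ} {E : Fin m → PauliString n} {lam : Fin m → ℝ}
    (hlam : ∀ a, |lam a| ≤ 1) (hk : ∀ a, (E a).support.card ≤ k)
    (hd : (dualInteractionGraph E).maxDegree ≤ d) (j : ℕ) :
    ∀ (l : ℕ) (V : PauliString n), V.support.card ≤ l →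
      ‖(commutatorCLM (pauliSum lam E) ^ j) V.toOp‖ ≤
        ∏ i ∈ Finset.range j, (2 * (d + 1) * (l + i * k) : ℝ) := by
  induction j with
  | zero => intro l V _; simp [PauliString.norm_toOp]
  | succ j ih =>
    intro l V hV
    -- The innermost commutator is expanded first: at most `l(d+1)` terms survive, with coefficients
    -- at most `2`, each a phase times a string on at most `l + k` qubits. The induction hypothesis
    -- is then used at `l + k`.
    rw [pow_succ, mul_apply_eq_comp, commutatorCLM_pauliSum, map_sum]
    set S := Finset.univ.filter fun a => ((E a).support ∩ V.support).Nonempty with hS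
    set B := ∏ i ∈ Finset.range j, (2 * (d + 1) * ((l + k : ℕ) + i * k) : ℝ) with hB
    have hB0 : 0 ≤ B := Finset.prod_nonneg fun i _ => by positivity
    have hterm : ∀ a, ‖(commutatorCLM (pauliSum lam E) ^ j)
        (((lam a : ℂ) * (1 - PauliString.sign V (E a))) • ((E a).toOp * V.toOp))‖ ≤
        if a ∈ S then 2 * B else 0 := by
      intro a
      by_cases ha : a ∈ S
      · rw [if_pos ha]
        obtain ⟨W, c, hc, hmul, hsupp⟩ := PauliString.exists_toOp_mul (E a) V
        have hW : W.support.card ≤ l + k := by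
          refine (Finset.card_le_card hsupp).trans ((Finset.card_union_le _ _).trans ?_)
          have := hk a
          omega
        rw [hmul, smul_smul, map_smul, norm_smul, norm_mul, norm_mul, hc, mul_one,
          Complex.norm_real, Real.norm_eq_abs]
        have h2 : ‖(1 - (PauliString.sign V (E a) : ℂ))‖ ≤ 2 := by
          rcases PauliString.sign_eq_one_or V (E a) with h | h <;> rw [h] <;> norm_num
        have h3 : |lam a| * ‖(1 - (PauliString.sign V (E a) : ℂ))‖ ≤ 1 * 2 := by
          gcongr
          exact hlam a
        rw [one_mul] at h3
        exact mul_le_mul h3 (ih _ W hW) (norm_nonneg _) two_pos.le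
      · rw [if_neg ha]
        have h1 : PauliString.sign V (E a) = 1 := by
          apply PauliString.sign_eq_one_of_disjoint
          rw [Finset.inter_comm]
          simpa [hS] using ha
        simp [h1]
    refine (norm_sum_le_of_le _ fun a _ => hterm a).trans ?_
    rw [Finset.sum_ite_mem, Finset.univ_inter, Finset.sum_const, nsmul_eq_mul,
      Finset.prod_range_succ']
    have hcard : (S.card : ℝ) ≤ l * (d + 1) := by
      have h1 := card_support_inter_nonempty_le hd V.support
      have h2 : S.card ≤ l * (d + 1) := h1.trans (Nat.mul_le_mul_right _ hV)
      exact_mod_cast h2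
    have hprod : ∏ i ∈ Finset.range j, (2 * (d + 1) * (l + (i + 1 : ℕ) * k) : ℝ) = B := by
      refine Finset.prod_congr rfl fun i _ => ?_
      push_cast; ring
    rw [hprod]
    calc (S.card : ℝ) * (2 * B) ≤ (l * (d + 1)) * (2 * B) := by gcongr
      _ = _ := by push_cast; ring

/-- Imaginary time evolution of a product of Pauli matrices under a local Hamiltonian is bounded
for short times. -/
lemma norm_imaginary_evolution_le_two {k d l : ℕ} {E : Fin m → PauliString n} {lam : Fin m → ℝ}
    (hlam : ∀ a, |lam a| ≤ 1) (hk : ∀ a, (E a).support.card ≤ k)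
    (hd : (dualInteractionGraph E).maxDegree ≤ d) {V : PauliString n} (hV : V.support.card ≤ l)
    {t : ℂ} (ht : ‖t‖ * (2 * (d + 1) * (l + k)) ≤ 1 / 2) :
    ‖NormedSpace.exp (t • pauliSum lam E) * V.toOp * NormedSpace.exp (-t • pauliSum lam E)‖ ≤ 2 := by
  refine norm_exp_conj_le_two (fun j => ?_) ht (by positivity)
  refine (norm_commutatorCLM_pow_le hlam hk hd j l V hV).trans ?_
  -- Since `l + ik ≤ (l + k)(i + 1)`, the product is at most `(2(d+1)(l+k))^j j!`.
  rw [← Finset.prod_range_add_one_eq_factorial, Nat.cast_prod, ← Finset.card_range j,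
    ← Finset.prod_const, Finset.card_range, ← Finset.prod_mul_distrib]
  refine Finset.prod_le_prod (fun i _ => by positivity) fun i _ => ?_
  rw [mul_assoc (2 * ((d : ℝ) + 1))]
  gcongr
  push_cast
  have : (0 : ℝ) ≤ i * l := by positivity
  have : (0 : ℝ) ≤ k := by positivity
  nlinarith

end LocalHamiltonian

/-! ### Spectral filter -/

section SpectralFilter

variable {ι : Type*} [Fintype ι] [DecidableEq ι]

/-- A smooth spectral cutoff removing the spectrum of a Hermitian matrix below `δ`. -/
lemma exists_spectral_filter {A : Matrix ι ι ℂ} (hA : A.IsHermitian) {δ : ℝ} (hδ : 0 < δ) :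
    ∃ Q R : Matrix ι ι ℂ, ‖Q‖ ≤ 1 ∧ ‖A * (1 - Q)‖ ≤ δ ∧ Commute A Q ∧ Q = R * A ∧ ‖R‖ ≤ δ⁻¹ := by
  have hsa : IsSelfAdjoint A := hA
  have hpos : ∀ x : ℝ, 0 < x ^ 2 + δ ^ 2 := fun x => by positivity
  have hne : ∀ x : ℝ, x ^ 2 + δ ^ 2 ≠ 0 := fun x => (hpos x).ne'
  have hc1 : Continuous fun x : ℝ => x ^ 2 / (x ^ 2 + δ ^ 2) := by fun_prop (disch := exact hne _)
  have hc2 : Continuous fun x : ℝ => x / (x ^ 2 + δ ^ 2) := by fun_prop (disch := exact hne _)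
  have hid : cfc (fun x : ℝ => x) A = A := cfc_id' ℝ A
  -- Both `A(1-Q)`, with symbol `xδ²/(x²+δ²)`, and `R` are controlled by `2|x|δ ≤ x² + δ²`.
  refine ⟨cfc (fun x : ℝ => x ^ 2 / (x ^ 2 + δ ^ 2)) A, cfc (fun x : ℝ => x / (x ^ 2 + δ ^ 2)) A,
    ?_, ?_, ?_, ?_, ?_⟩
  · refine norm_cfc_le zero_le_one fun x _ => ?_
    rw [Real.norm_of_nonneg (div_nonneg (sq_nonneg x) (hpos x).le), div_le_one (hpos x)]
    nlinarith
  · have h : A * (1 - cfc (fun x : ℝ => x ^ 2 / (x ^ 2 + δ ^ 2)) A) =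
        cfc (fun x : ℝ => x * (1 - x ^ 2 / (x ^ 2 + δ ^ 2))) A := by
      rw [cfc_mul (fun x : ℝ => x) (fun x : ℝ => 1 - x ^ 2 / (x ^ 2 + δ ^ 2)) A
        (by fun_prop) (continuous_const.sub hc1).continuousOn,
        cfc_sub (fun _ : ℝ => 1) (fun x : ℝ => x ^ 2 / (x ^ 2 + δ ^ 2)) A
        (by fun_prop) hc1.continuousOn, cfc_const_one ℝ A, hid]
    rw [h]
    refine norm_cfc_le hδ.le fun x _ => ?_
    have h2 : x * (1 - x ^ 2 / (x ^ 2 + δ ^ 2)) = x * δ ^ 2 / (x ^ 2 + δ ^ 2) := by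
      have := hne x
      field_simp
      ring
    rw [h2, Real.norm_eq_abs, abs_div, abs_mul, abs_of_pos (hpos x), abs_of_nonneg (sq_nonneg δ),
      div_le_iff₀ (hpos x)]
    nlinarith [sq_nonneg (|x| - δ), sq_abs x, abs_nonneg x]
  · have h := cfc_commute_cfc (fun x : ℝ => x) (fun x : ℝ => x ^ 2 / (x ^ 2 + δ ^ 2)) A
    rwa [hid] at h
  · have h : (fun x : ℝ => x ^ 2 / (x ^ 2 + δ ^ 2)) = fun x => x / (x ^ 2 + δ ^ 2) * x := by
      ext x; ring
    rw [h, cfc_mul (fun x : ℝ => x / (x ^ 2 + δ ^ 2)) (fun x : ℝ => x) A hc2.continuousOn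
      (by fun_prop), hid]
  · refine norm_cfc_le (inv_nonneg.2 hδ.le) fun x _ => ?_
    rw [Real.norm_eq_abs, abs_div, abs_of_pos (hpos x), div_le_iff₀ (hpos x), ← div_eq_inv_mul,
      le_div_iff₀ hδ]
    nlinarith [sq_nonneg (|x| - δ), sq_abs x, abs_nonneg x]

end SpectralFilter

/-! ### Localization at a qubit and Pauli averaging -/

section Localization

variable {n m : ℕ}

lemma isHermitian_pauliSum (w : Fin m → ℝ) (P : Fin m → PauliString n) :
    (pauliSum w P).IsHermitian := by
  rw [Matrix.IsHermitian, pauliSum, Matrix.conjTranspose_sum]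
  refine Finset.sum_congr rfl fun a _ => ?_
  rw [Matrix.conjTranspose_smul, (P a).isHermitian_toOp]
  simp

/-- The partial trace sees only the factor at `i`, whose trace is `2` for the identity and `0`
otherwise. -/
lemma traceOutQubit_toOp (i : Fin n) (P : PauliString n) :
    traceOutQubit i P.toOp = if P i = 0 then P.toOp else 0 := by
  ext x y
  have h : ∀ s, P.toOp (Function.update x i s) (Function.update y i s) =
      pauliMatrix (P i) s s * ∏ j ∈ Finset.univ.erase i, pauliMatrix (P j) (x j) (y j) := by
    intro s
    rw [PauliString.toOp, Matrix.of_apply, ← Finset.mul_prod_erase _ _ (Finset.mem_univ i)]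
    simp only [Function.update_self]
    congr 1
    refine Finset.prod_congr rfl fun j hj => ?_
    rw [Function.update_of_ne (Finset.ne_of_mem_erase hj),
      Function.update_of_ne (Finset.ne_of_mem_erase hj)]
  have h2 : P.toOp x y = pauliMatrix (P i) (x i) (y i) *
      ∏ j ∈ Finset.univ.erase i, pauliMatrix (P j) (x j) (y j) := by
    rw [PauliString.toOp, Matrix.of_apply, ← Finset.mul_prod_erase _ _ (Finset.mem_univ i)]
  rw [traceOutQubit, Matrix.of_apply]
  simp only [h, ← Finset.sum_mul]
  have h3 : ∀ a : Fin 4, ∑ s, pauliMatrix a s s = if a = 0 then 2 else 0 := by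
    intro a
    fin_cases a <;> norm_num [pauliMatrix, Fin.sum_univ_two]
  rw [h3]
  by_cases h0 : P i = 0
  · simp only [h0, if_true, h2, pauliMatrix_zero, Matrix.one_apply]
    split_ifs <;> ring
  · simp [h0]

lemma traceOutQubit_pauliSum (i : Fin n) (w : Fin m → ℝ) (P : Fin m → PauliString n) :
    traceOutQubit i (pauliSum w P) = ∑ a, (w a : ℂ) • traceOutQubit i (P a).toOp := by
  ext x y
  simp only [traceOutQubit, pauliSum, Matrix.of_apply, Matrix.sum_apply, Matrix.smul_apply]
  split_ifs with h
  · rw [Finset.sum_comm, Finset.sum_div]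
    simp only [smul_eq_mul, ← Finset.mul_sum, mul_div_assoc]
  · simp

lemma localizeAt_pauliSum (i : Fin n) (w : Fin m → ℝ) (P : Fin m → PauliString n) :
    localizeAt i (pauliSum w P) = pauliSum (fun a => if P a i = 0 then 0 else w a) P := by
  rw [localizeAt, traceOutQubit_pauliSum, pauliSum, pauliSum, ← Finset.sum_sub_distrib]
  refine Finset.sum_congr rfl fun a _ => ?_
  rw [traceOutQubit_toOp]
  by_cases h : P a i = 0 <;> simp [h]

/-- The localization at a qubit as the deviation from the average over Pauli conjugations. -/
lemma localizeAt_pauliSum_eq_sub (i : Fin n) (w : Fin m → ℝ) (P : Fin m → PauliString n) :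
    localizeAt i (pauliSum w P) = pauliSum w P -
      (4 : ℂ)⁻¹ • ∑ U ∈ PauliString.supportedOn {i}, U.toOp * pauliSum w P * U.toOp := by
  have hU : ∀ a, ∑ U ∈ PauliString.supportedOn {i}, U.toOp * (P a).toOp * U.toOp =
      (4 : ℂ) • (if P a i = 0 then (P a).toOp else 0) := by
    intro a
    -- `R` is the part of `P a` at qubit `i`, all that `U` detects. Pairing it with the trivial
    -- string, of sign `1`, puts the sum into the form of character orthogonality.
    let R : PauliString n := fun j => if j = i then P a i else 0
    have hR : ∀ U ∈ PauliString.supportedOn ({i} : Finset (Fin n)),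
        PauliString.sign U (P a) = PauliString.sign U R * PauliString.sign U (fun _ => 0) := by
      intro U hU
      rw [PauliString.sign, PauliString.sign, PauliString.sign, ← Finset.prod_mul_distrib]
      refine Finset.prod_congr rfl fun j _ => ?_
      by_cases hj : j = i
      · subst hj; simp [R, pauliSign]
      · have : U j = 0 := by
          by_contra h'
          exact hj (Finset.mem_singleton.1 (PauliString.mem_supportedOn.1 hU
            (PauliString.mem_support.2 h')))
        simp [this, pauliSign]
    simp only [PauliString.toOp_conj, ← Finset.sum_smul]
    rw [← Int.cast_sum, Finset.sum_congr rfl hR, PauliString.sum_sign_mul_sign]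
    · by_cases h : P a i = 0
      · have : R = fun _ => 0 := by funext j; simp [R, h]
        simp [this, h]
      · have : R ≠ fun _ => 0 := fun h' => h (by simpa [R] using congrFun h' i)
        simp [this, h]
    · intro j hj
      rw [PauliString.mem_support] at hj
      by_contra h'
      exact hj (if_neg (fun h => h' (Finset.mem_singleton.2 h)))
    · intro j hj
      exact absurd rfl (PauliString.mem_support.1 hj)
  rw [localizeAt, traceOutQubit_pauliSum]
  congr 1
  simp only [pauliSum, Finset.mul_sum, Finset.sum_mul]
  rw [Finset.sum_comm, Finset.smul_sum]
  refine Finset.sum_congr rfl fun a _ => ?_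
  simp only [mul_smul_comm, smul_mul_assoc]
  rw [← Finset.smul_sum, hU, traceOutQubit_toOp, smul_smul, smul_smul]
  congr 1
  ring

/-- Averaging over Pauli conjugations depolarizes: the square of a sum of Pauli products supported
in `L` becomes a multiple of the identity. -/
lemma sum_conj_pauliSum_sq {L : Finset (Fin n)} {w : Fin m → ℝ} {P : Fin m → PauliString n}
    (hL : ∀ a, w a ≠ 0 → (P a).support ⊆ L) :
    ∑ V ∈ PauliString.supportedOn L, V.toOp * (pauliSum w P * pauliSum w P) * V.toOp =
      (4 ^ L.card * ((pauliSum w P ^ 2).trace / 2 ^ n) : ℂ) • 1 := by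
  -- Strings may repeat in the family, so all pairs of indices with equal strings contribute.
  have htr : (pauliSum w P ^ 2).trace / 2 ^ n =
      ∑ a, ∑ b, if P a = P b then (w a * w b : ℂ) else 0 := by
    rw [div_eq_iff (pow_ne_zero _ two_ne_zero), sq, pauliSum, Finset.sum_mul, Matrix.trace_sum, Finset.sum_mul]
    refine Finset.sum_congr rfl fun a _ => ?_
    rw [Finset.mul_sum, Matrix.trace_sum, Finset.sum_mul]
    refine Finset.sum_congr rfl fun b _ => ?_
    rw [smul_mul_smul_comm, Matrix.trace_smul, PauliString.trace_toOp_mul]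
    split_ifs <;> simp
  have hconj : ∀ (V Q R : PauliString n), V.toOp * (Q.toOp * R.toOp) * V.toOp =
      ((PauliString.sign V Q * PauliString.sign V R : ℤ) : ℂ) • (Q.toOp * R.toOp) := by
    intro V Q R
    have h : V.toOp * (Q.toOp * R.toOp) * V.toOp =
        (V.toOp * Q.toOp * V.toOp) * (V.toOp * R.toOp * V.toOp) := by
      calc _ = V.toOp * Q.toOp * 1 * R.toOp * V.toOp := by noncomm_ring
        _ = _ := by rw [← V.toOp_mul_self]; noncomm_ring
    rw [h, PauliString.toOp_conj, PauliString.toOp_conj, smul_mul_smul_comm, Int.cast_mul]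
  rw [htr, Finset.mul_sum, Finset.sum_smul]
  have hsq : pauliSum w P * pauliSum w P =
      ∑ a, ∑ b, (w a * w b : ℂ) • ((P a).toOp * (P b).toOp) := by
    simp only [pauliSum, Finset.sum_mul_sum, smul_mul_smul_comm]
  simp only [hsq, Finset.mul_sum, Finset.sum_mul, mul_smul_comm, smul_mul_assoc, hconj]
  rw [Finset.sum_comm]
  refine Finset.sum_congr rfl fun a _ => ?_
  rw [Finset.sum_comm, Finset.sum_smul]
  refine Finset.sum_congr rfl fun b _ => ?_
  rw [← Finset.smul_sum, ← Finset.sum_smul, ← Int.cast_sum]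
  by_cases ha : w a = 0
  · simp [ha]
  by_cases hb : w b = 0
  · simp [hb]
  rw [PauliString.sum_sign_mul_sign (hL a ha) (hL b hb)]
  by_cases hab : P a = P b
  · rw [if_pos hab, if_pos hab, hab, PauliString.toOp_mul_self, smul_smul]
    congr 1
    push_cast
    ring
  · simp [hab]

end Localization

/-! ### Stability of smallness under local Pauli products -/

section KeyEstimate

variable {n m : ℕ}

open NormedSpace

lemma norm_exp_conj_mul_le_four {ι : Type*} [Fintype ι] [DecidableEq ι] {K X Y : Matrix ι ι ℂ}
    {θ : ℝ} (hX : ‖exp ((-θ : ℂ) • K) * X * exp ((θ : ℂ) • K)‖ ≤ 2)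
    (hY : ‖exp ((-θ : ℂ) • K) * Y * exp ((θ : ℂ) • K)‖ ≤ 2) :
    ‖exp ((-θ : ℂ) • K) * (X * Y) * exp ((θ : ℂ) • K)‖ ≤ 4 := by
  have h1 : exp ((θ : ℂ) • K) * exp ((-θ : ℂ) • K) = 1 := by
    rw [exp_smul_mul_exp_smul]; simp
  have h : exp ((-θ : ℂ) • K) * (X * Y) * exp ((θ : ℂ) • K) =
      (exp ((-θ : ℂ) • K) * X * exp ((θ : ℂ) • K)) *
        (exp ((-θ : ℂ) • K) * Y * exp ((θ : ℂ) • K)) := by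
    calc _ = exp ((-θ : ℂ) • K) * X * 1 * Y * exp ((θ : ℂ) • K) := by noncomm_ring
      _ = _ := by rw [← h1]; noncomm_ring
  rw [h]
  refine (norm_mul_le _ _).trans ?_
  calc _ ≤ (2 : ℝ) * 2 := mul_le_mul hX hY (norm_nonneg _) zero_le_two
    _ = 4 := by norm_num

/-- If `A = ∑ σ_b P_b` is small in the state `e^{2K}`, then it is small after the action of any
product of Pauli matrices which has a bounded imaginary time evolution. -/
lemma hsNorm_pauliSum_mul_toOp_mul_exp_le {d : ℕ} {P : Fin m → PauliString n} {σ : Fin m → ℝ}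
    (hσ : ∀ b, |σ b| ≤ 1) (hd : (dualInteractionGraph P).maxDegree ≤ d)
    {K : QubitOp n} (hK : K.IsHermitian) {V : PauliString n} {l : ℕ} (hl : V.support.card ≤ l)
    {θ : ℝ} (hθ0 : 0 ≤ θ) (hθ1 : θ ≤ 1)
    (hV : ‖exp ((-θ : ℂ) • K) * V.toOp * exp ((θ : ℂ) • K)‖ ≤ 2)
    (hP : ∀ b, ‖exp ((-θ : ℂ) • K) * (P b).toOp * exp ((θ : ℂ) • K)‖ ≤ 2)
    {κ : ℝ} (hκ0 : 0 < κ) (hκ1 : κ ≤ 1)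
    (hA : hsNorm (pauliSum σ P * exp K) = κ * hsNorm (exp K)) :
    hsNorm (pauliSum σ P * V.toOp * exp K) ≤
      (2 + 8 * (l * (d + 1))) * κ ^ (θ / 2) * hsNorm (exp K) := by
  set A := pauliSum σ P with hAdef
  set g := exp K with hg
  set N := hsNorm g with hN
  have hN0 : 0 ≤ N := hsNorm_nonneg _
  -- This choice balances the two errors: `‖A(1-Q)‖ ≤ δ` and `‖Qg‖ ≤ (κ/δ)N = δN`.
  set δ := κ ^ (1 / 2 : ℝ) with hδ
  have hδ0 : 0 < δ := Real.rpow_pos_of_pos hκ0 _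
  have hδδ : δ * δ = κ := by
    rw [hδ, ← Real.rpow_add hκ0]; norm_num
  obtain ⟨Q, R, hQ1, hAQ, hcomm, hQR, hR⟩ := exists_spectral_filter (isHermitian_pauliSum σ P) hδ0
  have hQg : hsNorm (Q * g) ≤ δ * N := by
    rw [hQR, mul_assoc]
    refine (hsNorm_mul_le _ _).trans ?_
    rw [hA]
    calc ‖R‖ * (κ * N) ≤ δ⁻¹ * (κ * N) := by gcongr
      _ = δ * N := by rw [← hδδ]; field_simp
  have hδθ : δ ≤ κ ^ (θ / 2) := Real.rpow_le_rpow_of_exponent_ge hκ0 hκ1 (by linarith)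
  have hκθ : κ ≤ κ ^ (θ / 2) := by
    calc κ = κ ^ (1 : ℝ) := (Real.rpow_one κ).symm
      _ ≤ _ := Real.rpow_le_rpow_of_exponent_ge hκ0 hκ1 (by linarith)
  set B := κ ^ (θ / 2) with hB
  have hB0 : 0 ≤ B := (Real.rpow_pos_of_pos hκ0 _).le
  -- Interpolation between `‖g‖ = N` and `‖Qg‖ ≤ δN` gains `δ^θ = κ^(θ/2)`.
  have hlocal : ∀ b, hsNorm (Q * ((P b).toOp * V.toOp) * g) ≤ 4 * B * N := by
    intro b
    refine (hsNorm_mul_exp_interpolation hK Q _ hQ1 hθ0 hθ1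
      (norm_exp_conj_mul_le_four (hP b) hV)).trans ?_
    have h4N : 0 ≤ 4 * N := by positivity
    calc (4 * N) ^ (1 - θ) * (4 * hsNorm (Q * g)) ^ θ
        ≤ (4 * N) ^ (1 - θ) * (4 * (δ * N)) ^ θ := by
          have := hsNorm_nonneg (Q * g)
          gcongr
      _ = (4 * N) ^ (1 - θ) * (4 * N) ^ θ * δ ^ θ := by
          rw [show 4 * (δ * N) = 4 * N * δ by ring, Real.mul_rpow h4N hδ0.le, mul_assoc]
      _ = 4 * N * B := by
          rw [← Real.rpow_add' h4N (by simp), sub_add_cancel, Real.rpow_one, hδ, hB,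
            ← Real.rpow_mul hκ0.le]
          congr 2
          ring
      _ = 4 * B * N := by ring
  set c : Fin m → ℂ := fun b => (σ b : ℂ) * (1 - PauliString.sign V (P b)) with hc
  -- `‖A‖` may grow with the number of terms, so `A` appears only next to `1 - Q`, next to `g`, or
  -- inside a commutator with `V`.
  have hdecomp : A * V.toOp * g = A * (1 - Q) * (V.toOp * g) + Q * V.toOp * (A * g) +
      ∑ b, c b • (Q * ((P b).toOp * V.toOp) * g) := by
    have h := commutatorCLM_pauliSum σ P V
    rw [commutatorCLM_apply, sub_eq_iff_eq_add] at h
    have h2 : ∑ b, c b • (Q * ((P b).toOp * V.toOp) * g) =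
        Q * (∑ b, c b • ((P b).toOp * V.toOp)) * g := by
      simp only [Finset.mul_sum, Finset.sum_mul, mul_smul_comm, smul_mul_assoc]
    rw [h2, eq_sub_of_add_eq h.symm, mul_sub (A : QubitOp n) 1 Q, hcomm.eq]
    noncomm_ring
  rw [hdecomp]
  have h1 : hsNorm (A * (1 - Q) * (V.toOp * g)) ≤ B * N := by
    refine (hsNorm_mul_le _ _).trans ?_
    have h2 := hsNorm_mul_le V.toOp g
    rw [PauliString.norm_toOp, one_mul] at h2
    exact mul_le_mul (hAQ.trans hδθ) h2 (hsNorm_nonneg _) hB0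
  have h2 : hsNorm (Q * V.toOp * (A * g)) ≤ B * N := by
    refine (hsNorm_mul_le _ _).trans ?_
    have h3 : ‖Q * V.toOp‖ ≤ 1 := by
      refine (norm_mul_le _ _).trans ?_
      rwa [PauliString.norm_toOp, mul_one]
    rw [hA]
    calc ‖Q * V.toOp‖ * (κ * N) ≤ 1 * (B * N) := by gcongr
      _ = B * N := one_mul _
  set S := Finset.univ.filter fun b => ((P b).support ∩ V.support).Nonempty with hS
  have hterm : ∀ b, hsNorm (c b • (Q * ((P b).toOp * V.toOp) * g)) ≤
      if b ∈ S then 8 * B * N else 0 := by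
    intro b
    rw [hsNorm_smul]
    by_cases hb : b ∈ S
    · rw [if_pos hb]
      have h3 : ‖c b‖ ≤ 1 * 2 := by
        simp only [hc]
        rw [norm_mul, Complex.norm_real, Real.norm_eq_abs]
        gcongr
        · exact hσ b
        · rcases PauliString.sign_eq_one_or V (P b) with h | h <;> rw [h] <;> norm_num
      calc _ ≤ (1 * 2) * (4 * B * N) := mul_le_mul h3 (hlocal b) (hsNorm_nonneg _) (by norm_num)
        _ = _ := by ring
    · rw [if_neg hb]
      have h1 : PauliString.sign V (P b) = 1 := by
        apply PauliString.sign_eq_one_of_disjoint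
        rw [Finset.inter_comm]
        simpa [hS] using hb
      simp [hc, h1]
  have h3 : hsNorm (∑ b, c b • (Q * ((P b).toOp * V.toOp) * g)) ≤
      (l * (d + 1)) * (8 * B * N) := by
    refine (hsNorm_sum_le _ _).trans ((Finset.sum_le_sum fun b _ => hterm b).trans ?_)
    rw [Finset.sum_ite_mem, Finset.univ_inter, Finset.sum_const, nsmul_eq_mul]
    have hcard : (S.card : ℝ) ≤ l * (d + 1) := by
      have h4 := (card_support_inter_nonempty_le hd V.support).trans (Nat.mul_le_mul_right _ hl)
      exact_mod_cast h4
    gcongr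
  calc _ ≤ B * N + B * N + (l * (d + 1)) * (8 * B * N) :=
        (hsNorm_add_le _ _).trans (add_le_add ((hsNorm_add_le _ _).trans (add_le_add h1 h2)) h3)
    _ = _ := by ring

end KeyEstimate

/-! ### From bounds near `i` to the trace of the localization -/

section Localized

variable {n m : ℕ}

/-- Bounds on `A V g` for all Pauli products `V` near qubit `i` bound the normalized trace of the
square of the localization of `A`. -/
lemma trace_localizeAt_sq_mul_le {σ : Fin m → ℝ} {P : Fin m → PauliString n} {i : Fin n}
    {L : Finset (Fin n)} (hi : i ∈ L) (hL : ∀ b, P b i ≠ 0 → (P b).support ⊆ L) {g : QubitOp n}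
    (hg : g.IsHermitian) {B : ℝ}
    (hB : ∀ V : PauliString n, V.support ⊆ L → hsNorm (pauliSum σ P * V.toOp * g) ≤ B) :
    (localizeAt i (pauliSum σ P) ^ 2).trace.re / 2 ^ n * hsNorm g ^ 2 ≤ (2 * B) ^ 2 := by
  set A := pauliSum σ P with hA
  set D := localizeAt i A with hD
  have hDs : D = pauliSum (fun b => if P b i = 0 then 0 else σ b) P := localizeAt_pauliSum i σ P
  have hDh : D.IsHermitian := hDs ▸ isHermitian_pauliSum _ _
  -- `D` is `A` minus the mean of the four `UAU`, and `UV` is a phase times a string on `L`, so the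
  -- two parts contribute `B` each.
  have hDV : ∀ V : PauliString n, V.support ⊆ L → hsNorm (D * V.toOp * g) ≤ 2 * B := by
    intro V hV
    have h : D * V.toOp * g = A * V.toOp * g -
        (4 : ℂ)⁻¹ • ∑ U ∈ PauliString.supportedOn {i}, U.toOp * (A * (U.toOp * V.toOp) * g) := by
      rw [hD, hA, localizeAt_pauliSum_eq_sub]
      simp only [sub_mul, smul_mul_assoc, Finset.sum_mul, mul_assoc]
    have hterm : ∀ U ∈ PauliString.supportedOn {i},
        hsNorm (U.toOp * (A * (U.toOp * V.toOp) * g)) ≤ B := by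
      intro U hU
      refine (hsNorm_mul_le _ _).trans ?_
      obtain ⟨W, c, hc, hmul, hsupp⟩ := PauliString.exists_toOp_mul U V
      rw [PauliString.norm_toOp, one_mul, hmul, mul_smul_comm, smul_mul_assoc, hsNorm_smul, hc,
        one_mul]
      refine hB W (hsupp.trans (Finset.union_subset ?_ hV))
      exact (PauliString.mem_supportedOn.1 hU).trans (Finset.singleton_subset_iff.2 hi)
    rw [h]
    refine (hsNorm_sub_le _ _).trans ?_
    have h4 := (hsNorm_sum_le _ _).trans (Finset.sum_le_card_nsmul _ _ _ hterm)
    rw [PauliString.card_supportedOn, Finset.card_singleton, nsmul_eq_mul] at h4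
    rw [hsNorm_smul, norm_inv]
    norm_num at h4 ⊢
    linarith [hB V hV]
  -- The left side is the trace of `g (∑ V D² V) g`, whose middle factor is scalar by
  -- depolarization.
  have hsum : ∑ V ∈ PauliString.supportedOn L, hsNorm (D * V.toOp * g) ^ 2 =
      4 ^ L.card * ((D ^ 2).trace.re / 2 ^ n * hsNorm g ^ 2) := by
    have h1 : ∀ V : PauliString n, ((hsNorm (D * V.toOp * g) ^ 2 : ℝ) : ℂ) =
        (g * (V.toOp * (D * D) * V.toOp) * g).trace := by
      intro V
      rw [← trace_conjTranspose_mul_self, Matrix.conjTranspose_mul, Matrix.conjTranspose_mul, hDh,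
        hg, V.isHermitian_toOp]
      simp only [mul_assoc]
    have h2 := sum_conj_pauliSum_sq (L := L) (w := fun b => if P b i = 0 then 0 else σ b) (P := P)
      (fun b hb => hL b fun h0 => hb (if_pos h0))
    rw [← hDs] at h2
    have h3 : ((∑ V ∈ PauliString.supportedOn L, hsNorm (D * V.toOp * g) ^ 2 : ℝ) : ℂ) =
        (4 ^ L.card * ((D ^ 2).trace / 2 ^ n)) * ((hsNorm g ^ 2 : ℝ) : ℂ) := by
      rw [← trace_conjTranspose_mul_self, hg, Complex.ofReal_sum]
      simp only [h1]
      rw [← Matrix.trace_sum, ← Finset.sum_mul, ← Finset.mul_sum, h2, mul_smul_comm, mul_one,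
        smul_mul_assoc, Matrix.trace_smul, smul_eq_mul]
    have h4 := congrArg Complex.re h3
    rw [Complex.ofReal_re, Complex.re_mul_ofReal] at h4
    rw [h4]
    have h5 : ((4 : ℂ) ^ L.card * ((D ^ 2).trace / 2 ^ n)) =
        (((4 : ℝ) ^ L.card / 2 ^ n : ℝ) : ℂ) * (D ^ 2).trace := by
      push_cast; ring
    rw [h5, Complex.re_ofReal_mul]
    ring
  have hle : ∑ V ∈ PauliString.supportedOn L, hsNorm (D * V.toOp * g) ^ 2 ≤
      4 ^ L.card * (2 * B) ^ 2 := by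
    have h := Finset.sum_le_card_nsmul (PauliString.supportedOn L)
      (fun V => hsNorm (D * V.toOp * g) ^ 2) ((2 * B) ^ 2) fun V hV =>
        pow_le_pow_left₀ (hsNorm_nonneg _) (hDV V (PauliString.mem_supportedOn.1 hV)) 2
    rw [PauliString.card_supportedOn, nsmul_eq_mul] at h
    exact_mod_cast h
  rw [hsum] at hle
  exact le_of_mul_le_mul_left hle (by positivity)

lemma trace_localizeAt_sq (σ : Fin m → ℝ) (P : Fin m → PauliString n) (i : Fin n) :
    (localizeAt i (pauliSum σ P) ^ 2).trace.re =
      hsNorm (localizeAt i (pauliSum σ P)) ^ 2 := by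
  have hDh : (localizeAt i (pauliSum σ P)).IsHermitian := by
    rw [localizeAt_pauliSum]; exact isHermitian_pauliSum _ _
  have h := trace_conjTranspose_mul_self (localizeAt i (pauliSum σ P))
  rw [hDh, ← sq] at h
  rw [h, Complex.ofReal_re]

/-- At most `d + 1` terms act on `i`, which bounds the operator norm of the localization. This a
priori bound lets the constant `c` normalize the base of the final power to at most `1`. -/
lemma trace_localizeAt_sq_div_le {d : ℕ} {σ : Fin m → ℝ} {P : Fin m → PauliString n}
    (hσ : ∀ b, |σ b| ≤ 1) (hd : (dualInteractionGraph P).maxDegree ≤ d) (i : Fin n) :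
    (localizeAt i (pauliSum σ P) ^ 2).trace.re / 2 ^ n ≤ (d + 1) ^ 2 := by
  rw [trace_localizeAt_sq, localizeAt_pauliSum]
  set D := pauliSum (fun b => if P b i = 0 then 0 else σ b) P with hD
  have hnorm : ‖D‖ ≤ d + 1 := by
    have hterm : ∀ b ∈ Finset.univ, ‖(((if P b i = 0 then 0 else σ b : ℝ) : ℂ)) • (P b).toOp‖ ≤
        if b ∈ Finset.univ.filter (fun b => ((P b).support ∩ {i}).Nonempty) then 1 else 0 := by
      intro b _
      rw [norm_smul, PauliString.norm_toOp, mul_one, Complex.norm_real, Real.norm_eq_abs]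
      by_cases hb : P b i = 0
      · simp only [hb, if_true, abs_zero]
        split_ifs <;> norm_num
      · rw [if_neg hb, if_pos]
        · exact hσ b
        · exact Finset.mem_filter.2 ⟨Finset.mem_univ _, i, by
            simpa [PauliString.mem_support] using hb⟩
    refine (norm_sum_le_of_le _ hterm).trans ?_
    rw [Finset.sum_ite_mem, Finset.univ_inter, Finset.sum_const, nsmul_eq_mul, mul_one]
    have h := card_support_inter_nonempty_le hd {i}
    rw [Finset.card_singleton, one_mul] at h
    exact_mod_cast h
  have hone : hsNorm (1 : QubitOp n) ^ 2 = 2 ^ n := by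
    have h := trace_conjTranspose_mul_self (1 : QubitOp n)
    rw [Matrix.conjTranspose_one, mul_one, Matrix.trace_one] at h
    have h2 : (hsNorm (1 : QubitOp n) ^ 2 : ℝ) = ((Fintype.card (Fin n → Fin 2) : ℕ) : ℝ) := by
      exact_mod_cast h.symm
    rw [h2]; simp
  rw [div_le_iff₀ (by positivity), ← hone, ← mul_pow]
  have h := hsNorm_mul_le D 1
  rw [mul_one] at h
  refine pow_le_pow_left₀ (hsNorm_nonneg _) (h.trans ?_) 2
  exact mul_le_mul_of_nonneg_right hnorm (hsNorm_nonneg _)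

end Localized

/-! ### Gibbs expectations as Hilbert–Schmidt ratios -/

section Gibbs

variable {n : ℕ}

open NormedSpace

/-- The expectation of the square of a Hermitian operator in a Gibbs state as a ratio of
Hilbert–Schmidt norms. -/
lemma trace_sq_mul_gibbsState {A H : QubitOp n} (hA : A.IsHermitian) (hH : H.IsHermitian) (β : ℝ) :
    (A ^ 2 * gibbsState β H).trace.re =
      hsNorm (A * exp ((-(β / 2 : ℝ) : ℂ) • H)) ^ 2 / hsNorm (exp ((-(β / 2 : ℝ) : ℂ) • H)) ^ 2 := by
  set g := exp ((-(β / 2 : ℝ) : ℂ) • H) with hg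
  have hgh : g.IsHermitian := by
    apply Matrix.IsHermitian.exp
    rw [Matrix.IsHermitian, Matrix.conjTranspose_smul, hH]
    simp
  have hgg : exp (-((β : ℂ) • H)) = g * g := by
    rw [hg, exp_smul_mul_exp_smul, ← neg_smul]
    congr 2
    push_cast
    ring
  have h1 : (g * g).trace = ((hsNorm g ^ 2 : ℝ) : ℂ) := by
    rw [← trace_conjTranspose_mul_self, hgh]
  have h2 : (A ^ 2 * (g * g)).trace = ((hsNorm (A * g) ^ 2 : ℝ) : ℂ) := by
    rw [← trace_conjTranspose_mul_self, Matrix.conjTranspose_mul, hA, hgh, sq, ← mul_assoc,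
      Matrix.trace_mul_comm]
    simp only [mul_assoc]
  rw [gibbsState, hgg, mul_smul_comm, Matrix.trace_smul, h1, h2, smul_eq_mul, ← Complex.ofReal_inv,
    ← Complex.ofReal_mul, Complex.ofReal_re, div_eq_inv_mul]

end Gibbs

/-! ### Choice of region, time and constants -/

section Main

variable {n m m' : ℕ}

open NormedSpace

/-- Polynomial comparison between the local infinite-temperature size of `A` and its size `κ²` in
the Gibbs state. -/
lemma trace_localizeAt_sq_div_le_rpow {k d k' d' : ℕ}
    {E : Fin m → PauliString n} {lam : Fin m → ℝ} {P : Fin m' → PauliString n} {σ : Fin m' → ℝ}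
    {β : ℝ} (hlam : ∀ a, |lam a| ≤ 1) (hk : ∀ a, (E a).support.card ≤ k)
    (hd : (dualInteractionGraph E).maxDegree ≤ d) (hσ : ∀ b, |σ b| ≤ 1)
    (hk' : ∀ b, (P b).support.card ≤ k') (hd' : (dualInteractionGraph P).maxDegree ≤ d')
    (hβ : 0 < β) (i : Fin n) {l : ℕ} (hl : l = 1 + (d' + 1) * k' + k')
    {θ : ℝ} (hθ0 : 0 ≤ θ) (hθ1 : θ ≤ 1) (hθ : θ * β * (2 * (d + 1) * (l + k)) ≤ 1)
    {κ : ℝ} (hκ0 : 0 < κ) (hκ1 : κ ≤ 1)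
    (hA : hsNorm (pauliSum σ P * exp ((-(β / 2 : ℝ) : ℂ) • pauliSum lam E)) =
      κ * hsNorm (exp ((-(β / 2 : ℝ) : ℂ) • pauliSum lam E))) :
    (localizeAt i (pauliSum σ P) ^ 2).trace.re / 2 ^ n ≤
      4 * (2 + 8 * (l * (d' + 1))) ^ 2 * κ ^ θ := by
  set K := (-(β / 2 : ℝ) : ℂ) • pauliSum lam E with hKdef
  have hK : K.IsHermitian := by
    rw [Matrix.IsHermitian, hKdef, Matrix.conjTranspose_smul, isHermitian_pauliSum]
    simp
  have hN : 0 < hsNorm (exp K) := by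
    refine (hsNorm_nonneg _).lt_of_ne' fun h => ?_
    exact (Matrix.isUnit_exp K).ne_zero (hsNorm_eq_zero.1 h)
  have hevol : ∀ V : PauliString n, V.support.card ≤ l →
      ‖exp ((-θ : ℂ) • K) * V.toOp * exp ((θ : ℂ) • K)‖ ≤ 2 := by
    intro V hV
    -- As `K = -(β/2)H`, the evolution time is `θβ/2`; this half turns the bound `1` in `hθ` into
    -- the required `1/2`.
    have h := norm_imaginary_evolution_le_two hlam hk hd hV (t := ((θ * (β / 2) : ℝ) : ℂ)) (by
      rw [Complex.norm_real, Real.norm_of_nonneg (by positivity)]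
      linarith)
    have h1 : (-θ : ℂ) • K = ((θ * (β / 2) : ℝ) : ℂ) • pauliSum lam E := by
      rw [hKdef, smul_smul]; congr 1; push_cast; ring
    have h2 : (θ : ℂ) • K = -((θ * (β / 2) : ℝ) : ℂ) • pauliSum lam E := by
      rw [hKdef, smul_smul]; congr 1; push_cast; ring
    rwa [h1, h2]
  -- The region holds `i` and the supports of the at most `d' + 1` terms touching it. The further
  -- `k'` in `l` makes `k' ≤ l` immediate, so the evolution bound also covers every `P b`.
  set L : Finset (Fin n) := insert i
    ((Finset.univ.filter fun b => ((P b).support ∩ {i}).Nonempty).biUnion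
      fun b => (P b).support) with hLdef
  have hLcard : L.card ≤ l := by
    have h1 := Finset.card_biUnion_le_card_mul
      (Finset.univ.filter fun b => ((P b).support ∩ {i}).Nonempty) (fun b => (P b).support) k'
      fun b _ => hk' b
    have h2 := card_support_inter_nonempty_le hd' {i}
    rw [Finset.card_singleton, one_mul] at h2
    have h3 := h1.trans (Nat.mul_le_mul_right k' h2)
    have h4 : L.card ≤ (d' + 1) * k' + 1 :=
      (Finset.card_insert_le i _).trans (Nat.succ_le_succ h3)
    omega
  have hL : ∀ b, P b i ≠ 0 → (P b).support ⊆ L := by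
    intro b hb
    refine (Finset.subset_biUnion_of_mem (fun b => (P b).support) ?_).trans
      (Finset.subset_insert _ _)
    exact Finset.mem_filter.2 ⟨Finset.mem_univ _, i, by
      simpa [PauliString.mem_support] using hb⟩
  have hB : ∀ V : PauliString n, V.support ⊆ L → hsNorm (pauliSum σ P * V.toOp * exp K) ≤
      (2 + 8 * (l * (d' + 1))) * κ ^ (θ / 2) * hsNorm (exp K) := by
    intro V hV
    have hVl : V.support.card ≤ l := (Finset.card_le_card hV).trans hLcard
    exact hsNorm_pauliSum_mul_toOp_mul_exp_le hσ hd' hK hVl hθ0 hθ1 (hevol V hVl)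
      (fun b => hevol _ ((hk' b).trans (by omega))) hκ0 hκ1 hA
  have h := trace_localizeAt_sq_mul_le (Finset.mem_insert_self i _) hL hK.exp hB
  have hκ2 : κ ^ (θ / 2) * κ ^ (θ / 2) = κ ^ θ := by
    rw [← Real.rpow_add hκ0, add_halves]
  refine le_of_mul_le_mul_right (h.trans_eq ?_) (pow_pos hN 2)
  rw [← hκ2]
  ring

end Main

theorem mainTheorem7 (k d k' d' : ℕ) :
    ∃ c : ℝ, 0 < c ∧ ∃ c' : ℝ, 0 < c' ∧
      ∀ (n m m' : ℕ)
        (E : Fin m → PauliString n) (lam : Fin m → ℝ)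
        (P : Fin m' → PauliString n) (σ : Fin m' → ℝ) (β : ℝ),
        -- the Hamiltonian `H = ∑ lam_a E_a`: distinct traceless terms, `k`-local, degree `d`
        Function.Injective E →
        (∀ a, (E a).toOp.trace = 0) →
        (∀ a, |lam a| ≤ 1) →
        (∀ a, (E a).support.card ≤ k) →
        (dualInteractionGraph E).maxDegree ≤ d →
        -- the operator `A = ∑ σ_b P_b`: `k'`-local, degree `d'`
        (∀ b, |σ b| ≤ 1) →
        (∀ b, (P b).support.card ≤ k') →
        (dualInteractionGraph P).maxDegree ≤ d' →
        0 < β →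
        ∀ i : Fin n,
          (c * ((localizeAt i (pauliSum σ P) ^ 2).trace.re / 2 ^ n)) ^ (6 + c' * β) ≤
            (pauliSum σ P ^ 2 * gibbsState β (pauliSum lam E)).trace.re := by
  obtain ⟨l, hl⟩ : ∃ l : ℕ, l = 1 + (d' + 1) * k' + k' := ⟨_, rfl⟩
  obtain ⟨a, ha⟩ : ∃ a : ℝ, a = 2 * (d + 1) * (l + k) := ⟨_, rfl⟩
  -- The first summand comes from the comparison with `κ ^ θ`, the second from the a priori bound,
  -- giving `C⁻¹ * x ≤ 1`.
  obtain ⟨C, hC⟩ : ∃ C : ℝ, C = 4 * (2 + 8 * (l * (d' + 1))) ^ 2 + (d' + 1) ^ 2 := ⟨_, rfl⟩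
  have ha0 : 0 ≤ a := by rw [ha]; positivity
  have hC0 : 0 < C := by rw [hC]; positivity
  refine ⟨C⁻¹, inv_pos.2 hC0, 2 * a + 1, by positivity, ?_⟩
  intro n m m' E lam P σ β _ _ hlam hk hd hσ hk' hd' hβ i
  rw [trace_sq_mul_gibbsState (isHermitian_pauliSum σ P) (isHermitian_pauliSum lam E), ← div_pow]
  set g := NormedSpace.exp ((-(β / 2 : ℝ) : ℂ) • pauliSum lam E) with hg
  have hgu : IsUnit g := Matrix.isUnit_exp _
  have hN : 0 < hsNorm g :=
    (hsNorm_nonneg _).lt_of_ne' fun h => hgu.ne_zero (hsNorm_eq_zero.1 h)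
  set x := (localizeAt i (pauliSum σ P) ^ 2).trace.re / 2 ^ n with hx
  obtain ⟨κ, hκ⟩ : ∃ κ : ℝ, κ = hsNorm (pauliSum σ P * g) / hsNorm g := ⟨_, rfl⟩
  rw [← hκ]
  have hA : hsNorm (pauliSum σ P * g) = κ * hsNorm g := by rw [hκ, div_mul_cancel₀ _ hN.ne']
  have hκ0 : 0 ≤ κ := by rw [hκ]; exact div_nonneg (hsNorm_nonneg _) hN.le
  have hx0 : 0 ≤ x := by rw [hx, trace_localizeAt_sq]; positivity
  have hxC : x ≤ C := (trace_localizeAt_sq_div_le hσ hd' i).trans (by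
    rw [hC]; exact le_add_of_nonneg_left (by positivity))
  have hcx0 : 0 ≤ C⁻¹ * x := by positivity
  have hcx1 : C⁻¹ * x ≤ 1 := by rwa [inv_mul_le_iff₀ hC0, mul_one]
  have haβ : 0 ≤ a * β := by positivity
  have hexp : 0 < 6 + (2 * a + 1) * β := by nlinarith
  -- The comparison needs `κ > 0`. If `κ = 0`, invertibility of `g` forces `A = 0`; if `κ > 1`, the
  -- left side is at most `1`.
  rcases hκ0.eq_or_lt with h0 | hκpos
  · have hA0 : pauliSum σ P = 0 := by
      rw [← h0, zero_mul, hsNorm_eq_zero] at hA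
      exact (hgu.mul_left_eq_zero).1 hA
    have hx00 : x = 0 := by
      rw [hx, localizeAt_pauliSum_eq_sub, hA0]
      simp
    rw [hx00, mul_zero, Real.zero_rpow hexp.ne']
    positivity
  rcases le_or_gt κ 1 with hκ1 | hκ1
  · have h1a : 0 < 1 + a * β := by positivity
    -- This `θ` satisfies `θ ≤ 1` and `θβa ≤ 1`. Recovering `κ²` takes the power `2/θ = 2 + 2aβ`,
    -- and raising it to `6 + (2a+1)β` is harmless for a base in `[0, 1]`.
    have hle := trace_localizeAt_sq_div_le_rpow (θ := (1 + a * β)⁻¹) hlam hk hd hσ hk' hd' hβ i hl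
      (by positivity) (inv_le_one_of_one_le₀ (by linarith)) (by
        rw [← ha, mul_assoc, inv_mul_le_iff₀ h1a]
        linarith) hκpos hκ1 hA
    have hcx : C⁻¹ * x ≤ κ ^ (1 + a * β)⁻¹ := by
      rw [inv_mul_le_iff₀ hC0]
      refine hle.trans (mul_le_mul_of_nonneg_right ?_ (Real.rpow_nonneg hκ0 _))
      rw [hC]
      exact le_add_of_nonneg_right (by positivity)
    calc (C⁻¹ * x) ^ (6 + (2 * a + 1) * β)
        ≤ (C⁻¹ * x) ^ ((1 + a * β) * 2) :=
          Real.rpow_le_rpow_of_exponent_ge' hcx0 hcx1 (by positivity) (by nlinarith)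
      _ ≤ (κ ^ (1 + a * β)⁻¹) ^ ((1 + a * β) * 2) := by gcongr
      _ = κ ^ 2 := by
          rw [← Real.rpow_mul hκ0, ← mul_assoc, inv_mul_cancel₀ h1a.ne', one_mul, Real.rpow_two]
  · calc (C⁻¹ * x) ^ (6 + (2 * a + 1) * β) ≤ 1 := Real.rpow_le_one hcx0 hcx1 hexp.le
      _ ≤ κ ^ 2 := by nlinarith
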